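/- **Definitions.** A *metric* on a set $X$ is a function $d_X\colon X\times X\to[0,\infty]$ with $d_X(x,x)=0$ and $d_X(x,x'')\le d_X(x,x')+d_X(x',x'')$ (neither finiteness, symmetry nor positive definiteness is required). A *metric measure space* (mm space) is a Polish space $X$ with its Borel $\sigma$-algebra, a metric $d_X$ that is lower semicontinuous on $X\times X$ (it need not metrize the topology), and a $\sigma$-finite Borel measure $\mu_X$. For Markov kernels $M\colon X\to Y$ and $N\colon Y\to Z$, $MN\colon X\to Z$ denotes their composite, $(MN)(C\mid x)=\int_Y N(C\mid y)\,M(dy\mid x)$, and $\mu_XM$ is the measure $B\mapsto\int_X M(B\mid x)\,\mu_X(dx)$ on $Y$. A *coupling* of Markov kernels $M\colon X\to Y$ and $N\colon X\to Z$ is a Markov kernel $\Pi\colon X\to Y\times Z$ such that $\Pi(x)$ has marginals $M(x)$ and $N(x)$ for every $x$; a *product* of $M\colon W\to Y$ and $N\colon X\to Z$ is a Markov kernel $\Pi\colon W\times X\to Y\times Z$ such that $\Pi(w,x)$ has marginals $M(w)$ and $N(x)$ for all $w,x$. For $1\le p<\infty$ and Markov kernels $M,N\colon X\to Y$ between mm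 spaces, $$W_p(M,N)=\inf_{\Pi}\left(\int_X\int_{Y\times Y}d_Y(y,y')^p\,\Pi(dy,dy'\mid x)\,\mu_X(dx)\right)^{1/p},$$ the infimum being over all couplings $\Pi$ of $M$ and $N$. This is a metric on the set of Markov kernels $X\to Y$, so that mm spaces and Markov kernels form a metric category $\mathsf{MMarkov}$ (a category with a metric on each hom-set). A morphism $f\colon X\to Y$ of a metric category is *short* if $d(fg,fg')\le d(g,g')$ for all objects $Z$ and all $g,g'\colon Y\to Z$, and $d(hf,h'f)\le d(h,h')$ for all objects $W$ and all $h,h'\colon W\to X$ (composition in diagrammatic order). **Proposition.** Let $1\le p<\infty$, let $X,Y$ be mm spaces and let $M\colon X\to Y$ be a Markov kernel. (a) $W_p(MN,MN')\le W_p(N,N')$ for all mm spaces $Z$ and all Markov kernels $N,N'\colon Y\to Z$ if and only if $M$ is *measure-decreasing*: $\mu_XM\le\mu_Y$. (b) $W_p(PM,P'M)\le W_p(P,P')$ for all mm spaces $W$ and all Markov kernels $P,P'\colon W\to X$ if and only if $M$ is *distance-decreasing of order $p$*: there is a product $\Pi\colon X\times X\to Y\times Y$ of $M$ with itself such that $$\left(\int_{Y\times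 Y}d_Y(y,y')^p\,\Pi(dy,dy'\mid x,x')\right)^{1/p}\le d_X(x,x')\qquad\text{for all }x,x'\in X.$$ Consequently, a Markov kernel is a short morphism of $\mathsf{MMarkov}$ (with the metrics $W_p$) if and only if it is distance-decreasing of order $p$ and measure-decreasing. These kernels contain the identities and are closed under composition, and the subcategory $\mathrm{Short}(\mathsf{MMarkov})$ of short morphisms is the category of all mm spaces and distance- and measure-decreasing Markov kernels. -/

import Mathlib

open CategoryTheory MeasureTheory ProbabilityTheory
open scoped ENNReal

universe u v w

noncomputable section

/-- A (Lawvere) metric: values in `[0, ∞]`, `d x x = 0` and the triangle inequality. Neither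
finiteness, nor symmetry, nor positive definiteness is required. -/
structure LawvereMetric (X : Type u) where
  dist : X → X → ℝ≥0∞
  dist_self : ∀ x, dist x x = 0
  dist_triangle : ∀ x y z, dist x z ≤ dist x y + dist y z

/-- A metric measure space: a Polish space with its Borel `σ`-algebra, a Lawvere metric `d` that is
lower semicontinuous for the (product) topology, and a `σ`-finite measure `μ`. The metric need not
metrize the topology. -/
structure MMSpace where
  carrier : Type u
  [topology : TopologicalSpace carrier]
  [polish : PolishSpace carrier]
  [measurable : MeasurableSpace carrier]
  [borel : BorelSpace carrier]
  d : LawvereMetric carrier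
  lsc : LowerSemicontinuous fun z : carrier × carrier => d.dist z.1 z.2
  μ : Measure carrier
  [sigmaFinite : SigmaFinite μ]

namespace MMSpace

instance : CoeSort MMSpace.{u} (Type u) := ⟨MMSpace.carrier⟩

instance (X : MMSpace.{u}) : TopologicalSpace X := X.topology
instance (X : MMSpace.{u}) : PolishSpace X := X.polish
instance (X : MMSpace.{u}) : MeasurableSpace X := X.measurable
instance (X : MMSpace.{u}) : BorelSpace X := X.borel
instance (X : MMSpace.{u}) : SigmaFinite X.μ := X.sigmaFinite

end MMSpace

/-- A Markov kernel between mm spaces: a morphism of the category of mm spaces and Markov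
kernels. -/
@[ext]
structure MarkovHom (X Y : MMSpace.{u}) where
  kernel : Kernel X Y
  [markov : IsMarkovKernel kernel]

instance {X Y : MMSpace.{u}} (M : MarkovHom X Y) : IsMarkovKernel M.kernel := M.markov

/-- The category of mm spaces and Markov kernels, with the usual composition of kernels (written
`M ≫ N` in diagrammatic order: `M` first, then `N`). -/
instance : Category MMSpace.{u} where
  Hom X Y := MarkovHom X Y
  id _ := ⟨Kernel.id⟩
  comp M N := ⟨N.kernel ∘ₖ M.kernel⟩
  id_comp M := MarkovHom.ext (Kernel.comp_id M.kernel)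
  comp_id M := MarkovHom.ext (Kernel.id_comp M.kernel)
  assoc M N L := MarkovHom.ext (Kernel.comp_assoc L.kernel N.kernel M.kernel).symm

instance {X Y : MMSpace.{u}} (M : X ⟶ Y) : IsMarkovKernel (MarkovHom.kernel M) :=
  MarkovHom.markov M

/-- `Π : X → Y × Z` is a coupling of `M : X → Y` and `N : X → Z`: a Markov kernel with marginals
`M` and `N`. -/
structure IsKernelCoupling {X : Type u} {Y : Type v} {Z : Type w} [MeasurableSpace X]
    [MeasurableSpace Y] [MeasurableSpace Z] (M : Kernel X Y) (N : Kernel X Z)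
    (P : Kernel X (Y × Z)) : Prop where
  markov : IsMarkovKernel P
  fst_eq : P.fst = M
  snd_eq : P.snd = N

/-- `Π : W × X → Y × Z` is a product of `M : W → Y` and `N : X → Z`: a Markov kernel whose
marginal on `Y` is `proj_W` followed by `M` and whose marginal on `Z` is `proj_X` followed by
`N`. -/
structure IsKernelProduct {W X Y Z : Type u} [MeasurableSpace W] [MeasurableSpace X]
    [MeasurableSpace Y] [MeasurableSpace Z] (M : Kernel W Y) (N : Kernel X Z)
    (P : Kernel (W × X) (Y × Z)) : Prop where
  markov : IsMarkovKernel P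
  fst_eq : P.fst = M.comap Prod.fst measurable_fst
  snd_eq : P.snd = N.comap Prod.snd measurable_snd

/-- The transport cost `(∫ d_Y(y, y')^p Π(dy, dy' | x) μ_X(dx))^{1/p}` of `Π : X → Y × Y`. -/
def transportCost (p : ℝ) {X Y : MMSpace.{u}} (P : Kernel X (Y × Y)) : ℝ≥0∞ :=
  (∫⁻ x, ∫⁻ z, Y.d.dist z.1 z.2 ^ p ∂(P x) ∂X.μ) ^ (1 / p)

/-- The Wasserstein metric of order `p` on Markov kernels `X → Y`. -/
def wassersteinDist (p : ℝ) {X Y : MMSpace.{u}} (M N : X ⟶ Y) : ℝ≥0∞ :=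
  ⨅ (P : Kernel X (Y × Y)) (_ : IsKernelCoupling M.kernel N.kernel P), transportCost p P

/-- `M : X → Y` is measure-decreasing: `μ_X M ≤ μ_Y`. -/
def MeasureDecreasing {X Y : MMSpace.{u}} (M : X ⟶ Y) : Prop :=
  X.μ.bind M.kernel ≤ Y.μ

/-- `M : X → Y` is distance-decreasing of order `p`: some product `Π` of `M` with itself satisfies
`(∫ d_Y(y, y')^p Π(dy, dy' | x, x'))^{1/p} ≤ d_X(x, x')` for all `x, x'`. -/
def DistanceDecreasing (p : ℝ) {X Y : MMSpace.{u}} (M : X ⟶ Y) : Prop :=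
  ∃ P : Kernel (X × X) (Y × Y), IsKernelProduct M.kernel M.kernel P ∧
    ∀ x x' : X, (∫⁻ z, Y.d.dist z.1 z.2 ^ p ∂(P (x, x'))) ^ (1 / p) ≤ X.d.dist x x'

/-- A metric category structure on a category: a metric on each hom-set. -/
structure MetricCategory (C : Type u) [Category.{v} C] where
  homMetric : ∀ X Y : C, LawvereMetric (X ⟶ Y)

namespace MetricCategory

variable {C : Type u} [Category.{v} C] (D : MetricCategory C)

/-- The distance between parallel morphisms. -/
def dist {X Y : C} (f g : X ⟶ Y) : ℝ≥0∞ := (D.homMetric X Y).dist f g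

/-- The short morphisms of a metric category: those that do not increase distances upon
pre-composition or post-composition. -/
def short : MorphismProperty C := fun X Y f =>
  (∀ (Z : C) (g g' : Y ⟶ Z), D.dist (f ≫ g) (f ≫ g') ≤ D.dist g g') ∧
  (∀ (W : C) (h h' : W ⟶ X), D.dist (h ≫ f) (h' ≫ f) ≤ D.dist h h')

instance : D.short.IsMultiplicative where
  id_mem X := ⟨fun Z g g' => by simp, fun W h h' => by simp⟩
  comp_mem f g hf hg :=
    ⟨fun Z k k' => by
      simpa only [Category.assoc] using (hf.1 Z (g ≫ k) (g ≫ k')).trans (hg.1 Z k k'),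
     fun W h h' => by
      simpa only [Category.assoc] using (hg.2 W (h ≫ f) (h' ≫ f)).trans (hf.2 W h h')⟩

end MetricCategory

/-! ### The Wasserstein metric satisfies the axioms of a Lawvere metric -/

theorem MMSpace.measurable_dist (Y : MMSpace.{u}) :
    Measurable fun z : Y × Y => Y.d.dist z.1 z.2 :=
  Y.lsc.measurable

theorem wassersteinDist_self (p : ℝ) (hp : 1 ≤ p) {X Y : MMSpace.{u}} (M : X ⟶ Y) :
    wassersteinDist p M M = 0 := by
  have hp0 : 0 < p := lt_of_lt_of_le zero_lt_one hp
  have hm : Measurable fun y : Y => (y, y) := by fun_prop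
  refine le_antisymm ?_ zero_le
  have hC : IsKernelCoupling M.kernel M.kernel (M.kernel.map fun y => (y, y)) := by
    refine ⟨Kernel.IsMarkovKernel.map _ hm, ?_, ?_⟩
    · rw [Kernel.fst_eq, ← Kernel.map_comp_right _ hm measurable_fst]
      exact Kernel.map_id _
    · rw [Kernel.snd_eq, ← Kernel.map_comp_right _ hm measurable_snd]
      exact Kernel.map_id _
  refine (iInf₂_le _ hC).trans ?_
  have hc : ∀ x, ∫⁻ z, Y.d.dist z.1 z.2 ^ p ∂(M.kernel.map (fun y => (y, y)) x) = 0 := by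
    intro x
    rw [Kernel.map_apply _ hm, lintegral_map (Y.measurable_dist.pow_const p) hm]
    simp [Y.d.dist_self, hp0]
  simp [transportCost, hc, hp0]

/-- Gluing of two kernels into `Y × Y` along their common middle marginal. -/
theorem exists_kernel_gluing {X : Type u} {Y : Type v} [MeasurableSpace X] [TopologicalSpace Y]
    [PolishSpace Y] [MeasurableSpace Y] [BorelSpace Y] (P Q : Kernel X (Y × Y))
    [IsMarkovKernel P] [IsMarkovKernel Q] (h : P.snd = Q.fst) :
    ∃ R : Kernel X ((Y × Y) × Y), IsMarkovKernel R ∧ R.fst = P ∧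
      R.map (fun z => (z.1.2, z.2)) = Q := by
  rcases isEmpty_or_nonempty Y with hY | hY
  · have hX : IsEmpty X := ⟨fun x => by
      have h1 : P x Set.univ = 1 := measure_univ
      rw [Set.eq_empty_of_isEmpty (Set.univ : Set (Y × Y)), measure_empty] at h1
      exact zero_ne_one h1⟩
    exact ⟨0, ⟨fun x => hX.elim x⟩, Kernel.ext fun x => hX.elim x, Kernel.ext fun x => hX.elim x⟩
  · have hg : Measurable fun q : X × (Y × Y) => (q.1, q.2.2) := by fun_prop
    have hf : Measurable fun z : (Y × Y) × Y => (z.1.2, z.2) := by fun_prop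
    refine ⟨P ⊗ₖ Q.condKernel.comap _ hg, inferInstance, Kernel.fst_compProd _ _, ?_⟩
    ext x s hs
    rw [Kernel.map_apply' _ hf _ hs, Kernel.compProd_apply (hf hs)]
    conv_rhs => rw [← Q.disintegrate Q.condKernel, Kernel.compProd_apply hs, ← h,
      Kernel.snd_apply, lintegral_map (Kernel.measurable_kernel_prodMk_left' hs x) measurable_snd]
    rfl

theorem wassersteinDist_triangle (p : ℝ) (hp : 1 ≤ p) {X Y : MMSpace.{u}} (L M N : X ⟶ Y) :
    wassersteinDist p L N ≤ wassersteinDist p L M + wassersteinDist p M N := by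
  have hp0 : 0 < p := lt_of_lt_of_le zero_lt_one hp
  have hd := Y.measurable_dist
  rw [wassersteinDist, wassersteinDist, wassersteinDist]
  refine ENNReal.le_iInf₂_add_iInf₂ ?_
  intro P hP Q hQ
  have := hP.markov
  have := hQ.markov
  obtain ⟨R, hR, hR1, hR2⟩ := exists_kernel_gluing P Q (hP.snd_eq.trans hQ.fst_eq.symm)
  have h13 : Measurable fun z : (Y × Y) × Y => (z.1.1, z.2) := by fun_prop
  have h23 : Measurable fun z : (Y × Y) × Y => (z.1.2, z.2) := by fun_prop
  have hcost : ∀ (f : (Y × Y) × Y → Y × Y), Measurable f →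
      transportCost p (R.map f) =
        (∫⁻ w, Y.d.dist (f w.2).1 (f w.2).2 ^ p ∂(X.μ ⊗ₘ R)) ^ (1 / p) := by
    intro f hf
    have hm : Measurable fun w : X × ((Y × Y) × Y) => Y.d.dist (f w.2).1 (f w.2).2 ^ p :=
      (hd.comp (hf.comp measurable_snd)).pow_const p
    rw [transportCost, Measure.lintegral_compProd hm]
    congr 2 with x
    rw [Kernel.map_apply _ hf, lintegral_map (hd.pow_const p) hf]
  have hC : IsKernelCoupling L.kernel N.kernel (R.map fun z => (z.1.1, z.2)) := by
    refine ⟨Kernel.IsMarkovKernel.map _ h13, ?_, ?_⟩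
    · rw [← hP.fst_eq, ← hR1, Kernel.fst_eq, Kernel.fst_eq, Kernel.fst_eq,
        ← Kernel.map_comp_right _ h13 measurable_fst,
        ← Kernel.map_comp_right _ measurable_fst measurable_fst]
      rfl
    · rw [← hQ.snd_eq, ← hR2, Kernel.snd_eq, Kernel.snd_eq,
        ← Kernel.map_comp_right _ h13 measurable_snd, ← Kernel.map_comp_right _ h23 measurable_snd]
      rfl
  refine (iInf₂_le _ hC).trans ?_
  rw [Kernel.fst_eq] at hR1
  rw [← hR1, ← hR2, hcost _ h13, hcost _ measurable_fst, hcost _ h23]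
  refine le_trans ?_ (ENNReal.lintegral_Lp_add_le
    (hd.comp (measurable_fst.comp measurable_snd)).aemeasurable
    (hd.comp (h23.comp measurable_snd)).aemeasurable hp)
  gcongr with w
  exact Y.d.dist_triangle _ _ _

/-- The metric category of mm spaces and Markov kernels, with the Wasserstein metric of order `p`,
`1 ≤ p < ∞`, on each set of Markov kernels `X → Y`. -/
def mmMarkov (p : ℝ) (hp : 1 ≤ p) : MetricCategory MMSpace.{u} where
  homMetric _ _ :=
    { dist := wassersteinDist p
      dist_self := wassersteinDist_self p hp
      dist_triangle := wassersteinDist_triangle p hp }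

/-- The Markov kernels that are both distance-decreasing of order `p` and measure-decreasing. -/
def distMeasDecreasing (p : ℝ) : MorphismProperty MMSpace.{u} := fun _ _ M =>
  DistanceDecreasing p M ∧ MeasureDecreasing M

end

/-! Sufficiency is a computation in both parts. Precomposing a coupling of `N` and `N'` with `M`
gives a coupling of the composites, with the same cost except that `μ_X M` replaces `μ_Y`. Following
a coupling by a distance-decreasing product of `M` with itself averages the pointwise bound.

Necessity uses test objects. For (a), two maps from `Y` to a two-point space, one constant and one
detecting a set `B`, lie within `μ_Y(B)^(1/p)` of each other, while every coupling of their
composites with `M` has `p`-th power cost at least `(μ_X M)(B)`. For (b), points of `X` are kernels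
from a one-point space, so `M x` and `M x'` have couplings of cost at most `r` for every `r > d(x,
x')^p`.

The crux is to choose such couplings measurably in `(x, x')` and to reach the bound itself:
`exists_kernelCoupling_le`. Over compact spaces the couplings of cost at most `s x` form a nonempty
compact set, because the cost integral is lower semicontinuous; this set depends measurably on `x`,
because projection along a compact factor is closed. Kuratowski–Ryll-Nardzewski selection then
applies. Polish spaces reduce to this case by embedding them in the Hilbert cube and extending the
cost by `lscExtension`. -/

/-! ### Measurable selection in compact metrizable spaces -/

/-- The infimum of a continuous function over the values of a measurable set-valued map is
measurable. -/
theorem measurable_iInf_of_measurableSet_hit {X T : Type*} [MeasurableSpace X]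
    [TopologicalSpace T] [CompactSpace T] {C : X → Set T} (hC : ∀ x, IsClosed (C x))
    (hm : ∀ F : Set T, IsClosed F → MeasurableSet {x | (C x ∩ F).Nonempty})
    {φ : T → ℝ≥0∞} (hφ : Continuous φ) :
    Measurable fun x => ⨅ t ∈ C x, φ t := by
  refine measurable_of_Iic fun a => ?_
  -- An empty infimum is `⊤`, so only for `a ≠ ⊤` does the bound force `C x` to be nonempty.
  rcases eq_or_ne a ⊤ with rfl | ha
  · simp
  convert hm (φ ⁻¹' Set.Iic a) (isClosed_Iic.preimage hφ) using 1
  ext x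
  simp only [Set.mem_preimage, Set.mem_Iic, Set.mem_ofPred_eq]
  constructor
  · intro h
    have hne : (C x).Nonempty := by
      by_contra h'
      rw [Set.not_nonempty_iff_eq_empty] at h'
      simp [h', ha] at h
    obtain ⟨t, ht, hmin⟩ := (hC x).isCompact.exists_isMinOn hne hφ.continuousOn
    exact ⟨t, ht, (le_iInf₂ fun t' ht' => hmin ht').trans h⟩
  · rintro ⟨t, ht, hta⟩
    exact (iInf₂_le t ht).trans hta

/-- Restricting a measurable closed-valued map to the minimizers of a continuous function gives a
measurable map. -/
theorem measurableSet_hit_minimizers {X T : Type*} [MeasurableSpace X]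
    [TopologicalSpace T] [CompactSpace T] {C : X → Set T} (hC : ∀ x, IsClosed (C x))
    (hm : ∀ F : Set T, IsClosed F → MeasurableSet {x | (C x ∩ F).Nonempty})
    {φ : T → ℝ≥0∞} (hφ : Continuous φ) {F : Set T} (hF : IsClosed F) :
    MeasurableSet {x | ((C x ∩ {t | φ t ≤ ⨅ t' ∈ C x, φ t'}) ∩ F).Nonempty} := by
  have h1 := measurable_iInf_of_measurableSet_hit hC hm hφ
  have h2 := measurable_iInf_of_measurableSet_hit (C := fun x => C x ∩ F)
    (fun x => (hC x).inter hF)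
    (fun G hG => by simpa only [Set.inter_assoc] using hm (F ∩ G) (hF.inter hG)) hφ
  -- By compactness, `F` contains a minimizer exactly when `C x` meets `F` and the infimum over `C x
  -- ∩ F` does not exceed that over `C x`.
  convert (hm F hF).inter (measurableSet_le h2 h1) using 1
  ext x
  simp only [Set.mem_ofPred_eq, Set.mem_inter_iff]
  constructor
  · rintro ⟨t, ⟨ht, hle⟩, htF⟩
    exact ⟨⟨t, ht, htF⟩, (iInf₂_le t ⟨ht, htF⟩).trans hle⟩
  · rintro ⟨hne, hle⟩
    obtain ⟨t, ht, hmin⟩ := ((hC x).inter hF).isCompact.exists_isMinOn hne hφ.continuousOn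
    exact ⟨t, ⟨ht.1, (le_iInf₂ fun t' ht' => hmin ht').trans hle⟩, ht.2⟩

/-- Successive restriction of a set-valued map to the minimizers of the functions `φ 0, φ 1, …`. -/
def iterMinimizers {X T : Type*} (C : X → Set T) (φ : ℕ → T → ℝ≥0∞) : ℕ → X → Set T
  | 0 => C
  | n + 1 => fun x => iterMinimizers C φ n x ∩
      {t | φ n t ≤ ⨅ t' ∈ iterMinimizers C φ n x, φ n t'}

open TopologicalSpace in
/-- **Kuratowski–Ryll-Nardzewski selection** with values in a compact metrizable space. -/
theorem exists_measurable_selection {X T : Type*} [MeasurableSpace X] [TopologicalSpace T]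
    [CompactSpace T] [MetrizableSpace T] [MeasurableSpace T] [BorelSpace T] {C : X → Set T}
    (hC : ∀ x, IsClosed (C x)) (hne : ∀ x, (C x).Nonempty)
    (hm : ∀ F : Set T, IsClosed F → MeasurableSet {x | (C x ∩ F).Nonempty}) :
    ∃ σ : X → T, Measurable σ ∧ ∀ x, σ x ∈ C x := by
  rcases isEmpty_or_nonempty X with hX | ⟨⟨x₀⟩⟩
  · exact ⟨fun x => hX.elim x, measurable_of_empty _, fun x => hX.elim x⟩
  have : Nonempty T := (hne x₀).to_type
  let := metrizableSpaceMetric T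
  -- Distances to a dense sequence separate points, so minimizing them one after another shrinks `C
  -- x` to a single point.
  let φ : ℕ → T → ℝ≥0∞ := fun n t => edist t (denseSeq T n)
  have hφ : ∀ n, Continuous (φ n) := fun n => by fun_prop
  let D := iterMinimizers C φ
  have hD : ∀ n, (∀ x, IsClosed (D n x)) ∧ (∀ x, (D n x).Nonempty) ∧
      ∀ F : Set T, IsClosed F → MeasurableSet {x | (D n x ∩ F).Nonempty} := by
    intro n
    induction n with
    | zero => exact ⟨hC, hne, hm⟩
    | succ n ih =>
      obtain ⟨h1, h2, h3⟩ := ih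
      refine ⟨fun x => (h1 x).inter (isClosed_le (hφ n) continuous_const), fun x => ?_,
        fun F hF => measurableSet_hit_minimizers h1 h3 (hφ n) hF⟩
      obtain ⟨t, ht, hmin⟩ := (h1 x).isCompact.exists_isMinOn (h2 x) (hφ n).continuousOn
      have hle : φ n t ≤ ⨅ t' ∈ D n x, φ n t' := le_iInf₂ fun t' ht' => hmin ht'
      exact ⟨t, ht, hle⟩
  have hanti : ∀ x n, D (n + 1) x ⊆ D n x := fun x n => Set.inter_subset_left
  have hinter : ∀ (F : Set T), IsClosed F → ∀ x, (∀ n, (D n x ∩ F).Nonempty) →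
      (⋂ n, D n x ∩ F).Nonempty := fun F hF x h =>
    IsCompact.nonempty_iInter_of_sequence_nonempty_isCompact_isClosed _
      (fun n => Set.inter_subset_inter_left _ (hanti x n)) h
      (((hD 0).1 x).inter hF).isCompact fun n => ((hD n).1 x).inter hF
  have hex : ∀ x, ∃ t, ∀ n, t ∈ D n x := fun x => by
    obtain ⟨t, ht⟩ := hinter Set.univ isClosed_univ x fun n => by simpa using (hD n).2.1 x
    exact ⟨t, fun n => (Set.mem_iInter.1 ht n).1⟩
  choose σ hσ using hex
  have huniq : ∀ x t, (∀ n, t ∈ D n x) → t = σ x := by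
    intro x t ht
    have hval : ∀ n, φ n t = φ n (σ x) := fun n =>
      le_antisymm ((ht (n + 1)).2.trans (iInf₂_le _ (hσ x n)))
        ((hσ x (n + 1)).2.trans (iInf₂_le _ (ht n)))
    have hall : ∀ y, edist t y = edist (σ x) y := by
      refine congrFun (DenseRange.equalizer (denseRange_denseSeq T)
        (g := fun y => edist t y) (h := fun y => edist (σ x) y) (by fun_prop) (by fun_prop)
        (funext hval))
    simpa using hall (σ x)
  refine ⟨σ, measurable_of_isClosed fun F hF => ?_, fun x => hσ x 0⟩
  -- If every `D n x` meets `F`, compactness puts a point of `F` in their intersection, which is `{σ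
  -- x}`.
  have : σ ⁻¹' F = ⋂ n, {x | (D n x ∩ F).Nonempty} := by
    ext x
    simp only [Set.mem_preimage, Set.mem_iInter, Set.mem_ofPred_eq]
    refine ⟨fun h n => ⟨σ x, hσ x n, h⟩, fun h => ?_⟩
    obtain ⟨t, ht⟩ := hinter F hF x h
    rw [Set.mem_iInter] at ht
    exact huniq x t (fun n => (ht n).1) ▸ (ht 0).2
  rw [this]
  exact MeasurableSet.iInter fun n => (hD n).2.2 F hF

/-! ### Probability measures on a compact metrizable space -/

open TopologicalSpace in
/-- On a compact metrizable space, the Giry `σ`-algebra is the Borel `σ`-algebra of the topology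
of weak convergence. -/
theorem borelSpace_probabilityMeasure {K : Type*} [TopologicalSpace K] [CompactSpace K]
    [MetrizableSpace K] [MeasurableSpace K] [BorelSpace K] :
    BorelSpace (ProbabilityMeasure K) := by
  have : SecondCountableTopology (ProbabilityMeasure K) := by
    let := metrizableSpaceMetric (ProbabilityMeasure K)
    infer_instance
  refine ⟨le_antisymm ?_ ?_⟩
  · let : MeasurableSpace (ProbabilityMeasure K) := borel _
    have : BorelSpace (ProbabilityMeasure K) := ⟨rfl⟩
    have hmeas : Measurable fun μ : ProbabilityMeasure K => (μ : Measure K) := by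
      refine Measurable.measure_of_isPiSystem_of_isProbabilityMeasure
        (borel_eq_generateFrom_isClosed (α := K) ▸ BorelSpace.measurable_eq) isPiSystem_isClosed
        fun F hF => ?_
      -- The mass of a closed set is a limit of integrals of continuous functions.
      refine measurable_of_tendsto_metrizable
        (f := fun n (μ : ProbabilityMeasure K) => ∫⁻ x, hF.apprSeq n x ∂(μ : Measure K))
        (fun n => ?_) ?_
      · exact (ProbabilityMeasure.continuous_lintegral_boundedContinuousFunction _).measurable
      · rw [tendsto_pi_nhds]
        exact fun μ => HasOuterApproxClosed.tendsto_lintegral_apprSeq hF _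
    exact hmeas.comap_le
  · let S : Set (Set (ProbabilityMeasure K)) :=
      {A | ∃ (f : BoundedContinuousFunction K NNReal) (U : Set ℝ≥0∞), IsOpen U ∧
        (fun μ : ProbabilityMeasure K => ∫⁻ x, f x ∂(μ : Measure K)) ⁻¹' U = A}
    have hS : (inferInstance : TopologicalSpace (ProbabilityMeasure K)) = generateFrom S := by
      refine le_antisymm (le_generateFrom ?_) ?_
      · rintro _ ⟨f, U, hU, rfl⟩
        exact hU.preimage
          (ProbabilityMeasure.continuous_lintegral_boundedContinuousFunction f)
      · rw [← continuous_id_iff_le]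
        refine (@ProbabilityMeasure.continuous_iff_forall_continuous_lintegral K _ _ _ _
          (generateFrom S) id).2 fun f => ?_
        exact (@continuous_def _ _ (generateFrom S) _ _).2
          fun U hU => GenerateOpen.basic _ ⟨f, U, hU, rfl⟩
    -- By second countability, a subbasis of the weak topology generates its Borel sets.
    rw [borel_eq_generateFrom_of_subbasis hS]
    refine MeasurableSpace.generateFrom_le ?_
    rintro _ ⟨f, U, hU, rfl⟩
    exact (Measure.measurable_lintegral f.continuous.measurable.coe_nnreal_ennreal).comp
      measurable_subtype_coe hU.measurableSet

open Filter Topology in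
/-- Integration of a lower semicontinuous function is lower semicontinuous for weak convergence. -/
theorem lowerSemicontinuous_lintegral_probabilityMeasure {K : Type*} [TopologicalSpace K]
    [TopologicalSpace.PseudoMetrizableSpace K] [TopologicalSpace.SeparableSpace K]
    [MeasurableSpace K] [BorelSpace K]
    {f : K → ℝ≥0∞} (hf : LowerSemicontinuous f) :
    LowerSemicontinuous fun μ : ProbabilityMeasure K => ∫⁻ x, f x ∂(μ : Measure K) := by
  have hsup : ∀ y : ℝ≥0∞, y = ⨆ n : ℕ, min y n := fun y => by
    rw [← inf_iSup_eq, ENNReal.iSup_natCast]; simp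
  have hmono : (fun μ : ProbabilityMeasure K => ∫⁻ x, f x ∂(μ : Measure K)) =
      fun μ : ProbabilityMeasure K => ⨆ n : ℕ, ∫⁻ x, min (f x) n ∂(μ : Measure K) := by
    ext μ
    rw [← lintegral_iSup (fun n => hf.measurable.min measurable_const)]
    · exact lintegral_congr fun x => hsup (f x)
    · intro m n hmn x
      dsimp only
      gcongr
  rw [hmono]
  refine lowerSemicontinuous_iSup fun n => ?_
  rw [lowerSemicontinuous_iff_isClosed_preimage]
  intro c
  refine IsSeqClosed.isClosed fun μs μ hμs hlim => ?_
  have hlt : ∀ x, min (f x) n ≠ ⊤ := fun x =>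
    ((min_le_right _ _).trans_lt (ENNReal.natCast_lt_top n)).ne
  -- Layer-cake formula: the superlevel sets are open, so the portmanteau inequality applies at each
  -- level `t`, and Fatou's lemma in `t` passes to the integral. Truncation at `n` keeps the
  -- integrand finite.
  have hcake : ∀ ν : Measure K, ∫⁻ x, min (f x) n ∂ν =
      ∫⁻ t in Set.Ioi (0 : ℝ), ν {x | t < (min (f x) n).toReal} := fun ν => by
    rw [← lintegral_eq_lintegral_meas_lt ν (Eventually.of_forall fun x => ENNReal.toReal_nonneg)
      (hf.measurable.min measurable_const).ennreal_toReal.aemeasurable]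
    exact lintegral_congr fun x => (ENNReal.ofReal_toReal (hlt x)).symm
  have hopen : ∀ t ∈ Set.Ioi (0 : ℝ), IsOpen {x | t < (min (f x) n).toReal} := fun t ht => by
    have : {x | t < (min (f x) n).toReal} =
        {x | ENNReal.ofReal t < f x} ∩ {_x | ENNReal.ofReal t < n} := by
      ext x
      rw [Set.mem_ofPred_eq, ← ENNReal.ofReal_lt_iff_lt_toReal (le_of_lt ht) (hlt x), lt_min_iff]
      rfl
    rw [this]
    exact (hf.isOpen_preimage _).inter isOpen_const
  simp only [Set.mem_preimage, Set.mem_Iic] at hμs ⊢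
  calc ∫⁻ x, min (f x) n ∂(μ : Measure K)
      = ∫⁻ t in Set.Ioi (0 : ℝ), (μ : Measure K) {x | t < (min (f x) n).toReal} := hcake _
    _ ≤ ∫⁻ t in Set.Ioi (0 : ℝ),
          liminf (fun i => (μs i : Measure K) {x | t < (min (f x) n).toReal}) atTop :=
        setLIntegral_mono' measurableSet_Ioi fun t ht =>
          ProbabilityMeasure.le_liminf_measure_open_of_tendsto hlim (hopen t ht)
    _ ≤ liminf (fun i => ∫⁻ t in Set.Ioi (0 : ℝ),
          (μs i : Measure K) {x | t < (min (f x) n).toReal}) atTop :=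
        lintegral_liminf_le fun i => Antitone.measurable fun s t hst =>
          measure_mono fun x hx => lt_of_le_of_lt hst hx
    _ ≤ c := by
        refine (liminf_le_liminf (v := fun _ => c) (Eventually.of_forall fun i => ?_)).trans
          (liminf_const c).le
        exact (hcake _).symm.trans_le (hμs i)

/-! ### Measurable selection of couplings -/

theorem IsKernelCoupling.fst_apply {X : Type u} {Y : Type v} {Z : Type w} [MeasurableSpace X]
    [MeasurableSpace Y] [MeasurableSpace Z] {M : Kernel X Y} {N : Kernel X Z}
    {P : Kernel X (Y × Z)} (h : IsKernelCoupling M N P) (x : X) : (P x).fst = M x := by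
  rw [← h.fst_eq, Kernel.fst_apply, Measure.fst]

theorem IsKernelCoupling.snd_apply {X : Type u} {Y : Type v} {Z : Type w} [MeasurableSpace X]
    [MeasurableSpace Y] [MeasurableSpace Z] {M : Kernel X Y} {N : Kernel X Z}
    {P : Kernel X (Y × Z)} (h : IsKernelCoupling M N P) (x : X) : (P x).snd = N x := by
  rw [← h.snd_eq, Kernel.snd_apply, Measure.snd]

theorem isKernelCoupling_of_forall {X : Type u} {Y : Type v} {Z : Type w} [MeasurableSpace X]
    [MeasurableSpace Y] [MeasurableSpace Z] {M : Kernel X Y} {N : Kernel X Z}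
    {P : Kernel X (Y × Z)} (hP : IsMarkovKernel P) (h1 : ∀ x, (P x).fst = M x)
    (h2 : ∀ x, (P x).snd = N x) : IsKernelCoupling M N P :=
  ⟨hP, Kernel.ext fun x => (Kernel.fst_apply P x).trans (h1 x),
    Kernel.ext fun x => (Kernel.snd_apply P x).trans (h2 x)⟩

open TopologicalSpace in
/-- Measurable selection of couplings of bounded cost, for kernels into compact metrizable
spaces. -/
theorem exists_kernelCoupling_le_of_compactSpace {X : Type u} {K : Type v} {L : Type w}
    [MeasurableSpace X]
    [TopologicalSpace K] [CompactSpace K] [PolishSpace K] [MeasurableSpace K] [BorelSpace K]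
    [TopologicalSpace L] [CompactSpace L] [PolishSpace L] [MeasurableSpace L] [BorelSpace L]
    (M : Kernel X K) (N : Kernel X L) [IsMarkovKernel M] [IsMarkovKernel N]
    {c : K × L → ℝ≥0∞} (hc : LowerSemicontinuous c) {s : X → ℝ≥0∞} (hs : Measurable s)
    (h : ∀ x r, s x < r → ∃ π : Measure (K × L), π.fst = M x ∧ π.snd = N x ∧ ∫⁻ z, c z ∂π ≤ r) :
    ∃ P : Kernel X (K × L), IsKernelCoupling M N P ∧ ∀ x, ∫⁻ z, c z ∂(P x) ≤ s x := by
  have := borelSpace_probabilityMeasure (K := K)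
  have := borelSpace_probabilityMeasure (K := L)
  have := borelSpace_probabilityMeasure (K := K × L)
  have hlsc := lowerSemicontinuous_lintegral_probabilityMeasure hc
  have : SecondCountableTopology (ProbabilityMeasure K) := by
    let := metrizableSpaceMetric (ProbabilityMeasure K)
    infer_instance
  have : SecondCountableTopology (ProbabilityMeasure L) := by
    let := metrizableSpaceMetric (ProbabilityMeasure L)
    infer_instance
  let m : X → ProbabilityMeasure K := fun x => ⟨M x, inferInstance⟩
  let n : X → ProbabilityMeasure L := fun x => ⟨N x, inferInstance⟩
  have hm : Measurable m := M.measurable.subtype_mk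
  have hn : Measurable n := N.measurable.subtype_mk
  let f1 : ProbabilityMeasure (K × L) → ProbabilityMeasure K := fun π =>
    π.map measurable_fst.aemeasurable
  let f2 : ProbabilityMeasure (K × L) → ProbabilityMeasure L := fun π =>
    π.map measurable_snd.aemeasurable
  have hf1 : Continuous f1 := ProbabilityMeasure.continuous_map continuous_fst
  have hf2 : Continuous f2 := ProbabilityMeasure.continuous_map continuous_snd
  let Γ : X → Set (ProbabilityMeasure (K × L)) := fun x => {π | f1 π = m x} ∩ {π | f2 π = n x}
  have hΓ : ∀ x, IsClosed (Γ x) := fun x =>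
    (isClosed_eq hf1 continuous_const).inter (isClosed_eq hf2 continuous_const)
  let C : X → Set (ProbabilityMeasure (K × L)) := fun x =>
    Γ x ∩ {π | ∫⁻ z, c z ∂(π : Measure (K × L)) ≤ s x}
  have hC : ∀ x, IsClosed (C x) := fun x => (hΓ x).inter (hlsc.isClosed_preimage _)
  have hΓmem : ∀ x (π : ProbabilityMeasure (K × L)), π ∈ Γ x ↔
      (π : Measure (K × L)).fst = M x ∧ (π : Measure (K × L)).snd = N x := fun x π =>
    and_congr (Subtype.ext_iff (a1 := f1 π) (a2 := m x)) (Subtype.ext_iff (a1 := f2 π) (a2 := n x))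
  -- A lower semicontinuous cost attains its minimum on the compact set of couplings; the minimum is
  -- at most every `r > s x`, hence at most `s x`.
  have hne : ∀ x, (C x).Nonempty := by
    intro x
    have hΓne : (Γ x).Nonempty :=
      ⟨⟨(M x).prod (N x), inferInstance⟩, (hΓmem x _).2 ⟨Measure.fst_prod, Measure.snd_prod⟩⟩
    obtain ⟨π, hπ, hmin⟩ := LowerSemicontinuousOn.exists_isMinOn hΓne (hΓ x).isCompact
      (hlsc.lowerSemicontinuousOn _)
    refine ⟨π, hπ, ?_⟩
    refine le_of_forall_gt_imp_ge_of_dense (a₂ := s x) fun r hr => ?_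
    obtain ⟨ρ, h1, h2, h3⟩ := h x r hr
    have : IsProbabilityMeasure ρ := ⟨by
      rw [← Measure.fst_univ, h1]; exact measure_univ⟩
    exact (hmin ((hΓmem x ⟨ρ, this⟩).2 ⟨h1, h2⟩) : _ ≤ _).trans h3
  have hhit : ∀ F : Set (ProbabilityMeasure (K × L)), IsClosed F →
      MeasurableSet {x | (C x ∩ F).Nonempty} := by
    intro F hF
    -- The hitting set of `F` is the preimage, under the measurable map `x ↦ (m x, n x, s x)`, of
    -- the projection of the closed set `G` along a compact factor.
    let G : Set ((ProbabilityMeasure K × ProbabilityMeasure L × ℝ≥0∞) ×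
        ProbabilityMeasure (K × L)) :=
      {q | f1 q.2 = q.1.1} ∩ {q | f2 q.2 = q.1.2.1} ∩
        {q | ∫⁻ z, c z ∂(q.2 : Measure (K × L)) ≤ q.1.2.2} ∩ {q | q.2 ∈ F}
    have hG : IsClosed G := by
      refine (((isClosed_eq (by fun_prop) (by fun_prop)).inter
        (isClosed_eq (by fun_prop) (by fun_prop))).inter ?_).inter (hF.preimage continuous_snd)
      exact (lowerSemicontinuous_iff_isClosed_epigraph.1 hlsc).preimage
        (f := fun q : (ProbabilityMeasure K × ProbabilityMeasure L × ℝ≥0∞) ×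
          ProbabilityMeasure (K × L) => (q.2, q.1.2.2)) (by fun_prop)
    have hG' : IsClosed (Prod.fst '' G) := isClosedMap_fst_of_compactSpace G hG
    have hmap : Measurable fun x => (m x, n x, s x) := hm.prodMk (hn.prodMk hs)
    convert hmap hG'.measurableSet using 1
    ext x
    constructor
    · rintro ⟨π, ⟨⟨h1, h2⟩, h3⟩, h4⟩
      exact ⟨((m x, n x, s x), π), ⟨⟨⟨h1, h2⟩, h3⟩, h4⟩, rfl⟩
    · rintro ⟨⟨_, π⟩, ⟨⟨⟨h1, h2⟩, h3⟩, h4⟩, rfl⟩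
      exact ⟨π, ⟨⟨h1, h2⟩, h3⟩, h4⟩
  obtain ⟨σ, hσ, hσC⟩ := exists_measurable_selection hC hne hhit
  refine ⟨⟨fun x => (σ x : Measure (K × L)), measurable_subtype_coe.comp hσ⟩,
    isKernelCoupling_of_forall
      ⟨fun x => inferInstanceAs (IsProbabilityMeasure (σ x : Measure (K × L)))⟩
      (fun x => ((hΓmem x _).1 (hσC x).1).1) (fun x => ((hΓmem x _).1 (hσC x).1).2),
    fun x => (hσC x).2⟩

/-! ### From compact to Polish spaces -/

/-- The largest lower semicontinuous function on `B` whose composition with `j : A → B` is at most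
`c`. -/
noncomputable def lscExtension {A B : Type*} [TopologicalSpace B] (j : A → B) (c : A → ℝ≥0∞)
    (z : B) : ℝ≥0∞ :=
  ⨆ U : TopologicalSpace.Opens B, (U : Set B).indicator (fun _ => ⨅ w ∈ j ⁻¹' U, c w) z

theorem lowerSemicontinuous_lscExtension {A B : Type*} [TopologicalSpace B] (j : A → B)
    (c : A → ℝ≥0∞) : LowerSemicontinuous (lscExtension j c) :=
  lowerSemicontinuous_iSup fun U => U.isOpen.lowerSemicontinuous_indicator zero_le

/-- For `r < c a`, the open set `{c > r}` is the trace of some open `U` in `B`, and the term of the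
supremum at `U` is at least `r`. -/
theorem lscExtension_apply {A B : Type*} [TopologicalSpace A] [TopologicalSpace B] {j : A → B}
    (hj : Topology.IsInducing j) {c : A → ℝ≥0∞} (hc : LowerSemicontinuous c) (a : A) :
    lscExtension j c (j a) = c a := by
  refine le_antisymm (iSup_le fun U => ?_) (le_of_forall_lt fun t ht => ?_)
  · by_cases ha : j a ∈ U
    · rw [Set.indicator_of_mem (by exact ha)]
      exact iInf₂_le a ha
    · rw [Set.indicator_of_notMem (by exact ha)]
      exact zero_le
  · obtain ⟨r, htr, hra⟩ := exists_between ht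
    obtain ⟨U, hU, hUV⟩ := hj.isOpen_iff.1 (hc.isOpen_preimage r)
    refine htr.trans_le (le_iSup_of_le ⟨U, hU⟩ ?_)
    have ha : j a ∈ U := by
      have : a ∈ j ⁻¹' U := hUV ▸ hra
      exact this
    rw [Set.indicator_of_mem (by exact ha)]
    refine le_iInf₂ fun w hw => le_of_lt ?_
    have : w ∈ c ⁻¹' Set.Ioi r := hUV ▸ hw
    exact this

/-- Measurable selection of couplings of bounded cost: if `s x` bounds the optimal transport cost
between `M x` and `N x` for each `x`, then some coupling of `M` and `N` has cost at most `s x` for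
each `x`. -/
theorem exists_kernelCoupling_le {X : Type u} {Y : Type v} {Z : Type w} [MeasurableSpace X]
    [TopologicalSpace Y] [PolishSpace Y] [MeasurableSpace Y] [BorelSpace Y]
    [TopologicalSpace Z] [PolishSpace Z] [MeasurableSpace Z] [BorelSpace Z]
    (M : Kernel X Y) (N : Kernel X Z) [IsMarkovKernel M] [IsMarkovKernel N]
    {c : Y × Z → ℝ≥0∞} (hc : LowerSemicontinuous c) {s : X → ℝ≥0∞} (hs : Measurable s)
    (h : ∀ x r, s x < r → ∃ π : Measure (Y × Z), π.fst = M x ∧ π.snd = N x ∧ ∫⁻ z, c z ∂π ≤ r) :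
    ∃ P : Kernel X (Y × Z), IsKernelCoupling M N P ∧ ∀ x, ∫⁻ z, c z ∂(P x) ≤ s x := by
  obtain ⟨i, hi⟩ : ∃ i : Y → ℕ → unitInterval, Topology.IsEmbedding i := by
    let := TopologicalSpace.upgradeIsCompletelyMetrizable Y
    exact Metric.PiNatEmbed.exists_embedding_to_hilbert_cube
  obtain ⟨k, hk⟩ : ∃ k : Z → ℕ → unitInterval, Topology.IsEmbedding k := by
    let := TopologicalSpace.upgradeIsCompletelyMetrizable Z
    exact Metric.PiNatEmbed.exists_embedding_to_hilbert_cube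
  -- A continuous injection from a Polish space is a measurable embedding (Lusin–Souslin), even if
  -- its range is not closed.
  have him : MeasurableEmbedding i := hi.continuous.measurableEmbedding hi.injective
  have hkm : MeasurableEmbedding k := hk.continuous.measurableEmbedding hk.injective
  let j := Prod.map i k
  have hj : Topology.IsEmbedding j := hi.prodMap hk
  have hjm : MeasurableEmbedding j := hj.continuous.measurableEmbedding hj.injective
  have := Kernel.IsMarkovKernel.map M him.measurable
  have := Kernel.IsMarkovKernel.map N hkm.measurable
  have hcost : ∀ π : Measure (Y × Z), ∫⁻ z, lscExtension j c z ∂(π.map j) = ∫⁻ z, c z ∂π :=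
    fun π => by
      rw [lintegral_map (lowerSemicontinuous_lscExtension j c).measurable hjm.measurable]
      exact lintegral_congr fun a => lscExtension_apply hj.isInducing hc a
  have hfst : ∀ π : Measure (Y × Z), (π.map j).fst = π.fst.map i := fun π => by
    rw [Measure.fst, Measure.fst, Measure.map_map measurable_fst hjm.measurable,
      Measure.map_map him.measurable measurable_fst]
    rfl
  have hsnd : ∀ π : Measure (Y × Z), (π.map j).snd = π.snd.map k := fun π => by
    rw [Measure.snd, Measure.snd, Measure.map_map measurable_snd hjm.measurable,
      Measure.map_map hkm.measurable measurable_snd]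
    rfl
  obtain ⟨Q, hQ, hQs⟩ := exists_kernelCoupling_le_of_compactSpace (M.map i) (N.map k)
    (lowerSemicontinuous_lscExtension j c) hs fun x r hr => by
      obtain ⟨π, h1, h2, h3⟩ := h x r hr
      exact ⟨π.map j, by rw [hfst, h1, Kernel.map_apply _ him.measurable],
        by rw [hsnd, h2, Kernel.map_apply _ hkm.measurable], (hcost π).trans_le h3⟩
  have hQm := hQ.markov
  have hQfst : ∀ x, (Q x).fst = (M x).map i := fun x => by
    rw [hQ.fst_apply, Kernel.map_apply _ him.measurable]
  have hQsnd : ∀ x, (Q x).snd = (N x).map k := fun x => by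
    rw [hQ.snd_apply, Kernel.map_apply _ hkm.measurable]
  -- Each marginal of `Q x` is carried by the embedded copy of its space, so `Q x` is carried by the
  -- range of `j` and can be pulled back.
  have hrange : ∀ x, ∀ᵐ z ∂(Q x), z ∈ Set.range j := by
    intro x
    have h1 : ∀ᵐ y ∂(Q x).fst, y ∈ Set.range i := by
      rw [hQfst]
      exact (him.ae_map_iff).2 (Filter.Eventually.of_forall fun y => ⟨y, rfl⟩)
    have h2 : ∀ᵐ z ∂(Q x).snd, z ∈ Set.range k := by
      rw [hQsnd]
      exact (hkm.ae_map_iff).2 (Filter.Eventually.of_forall fun y => ⟨y, rfl⟩)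
    filter_upwards [ae_of_ae_map measurable_fst.aemeasurable h1,
      ae_of_ae_map measurable_snd.aemeasurable h2] with z hz1 hz2
    rw [Set.range_prodMap]
    exact ⟨hz1, hz2⟩
  have hmapj : ∀ x, ((Q.comapRight hjm) x).map j = Q x := fun x => by
    rw [Kernel.comapRight_apply, hjm.map_comap, Measure.restrict_eq_self_of_ae_mem (hrange x)]
  refine ⟨Q.comapRight hjm, isKernelCoupling_of_forall ?_ (fun x => ?_) (fun x => ?_), fun x => ?_⟩
  · exact Kernel.IsMarkovKernel.comapRight Q hjm fun x => 
      (mem_ae_iff_prob_eq_one hjm.measurableSet_range).1 (hrange x)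
  · rw [← him.map_injective.eq_iff, ← hfst, hmapj, hQfst]
  · rw [← hkm.map_injective.eq_iff, ← hsnd, hmapj, hQsnd]
  · rw [← hcost, hmapj]
    exact hQs x

/-! ### Sufficiency of the two conditions -/

theorem MMSpace.lowerSemicontinuous_dist_rpow (Y : MMSpace.{u}) {p : ℝ} (hp : 0 ≤ p) :
    LowerSemicontinuous fun z : Y × Y => Y.d.dist z.1 z.2 ^ p :=
  (ENNReal.continuous_rpow_const (y := p)).comp_lowerSemicontinuous Y.lsc
    (ENNReal.monotone_rpow_of_nonneg hp)

theorem wassersteinDist_le_transportCost (p : ℝ) {X Y : MMSpace.{u}} {M N : X ⟶ Y}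
    {P : Kernel X (Y × Y)} (hP : IsKernelCoupling M.kernel N.kernel P) :
    wassersteinDist p M N ≤ transportCost p P :=
  iInf₂_le P hP

/-- Precomposing a coupling with a Markov kernel gives a coupling of the composites. -/
theorem IsKernelCoupling.comp {X Y Z : MMSpace.{u}} (M : X ⟶ Y) {N N' : Y ⟶ Z}
    {P : Kernel Y (Z × Z)} (hP : IsKernelCoupling N.kernel N'.kernel P) :
    IsKernelCoupling (M ≫ N).kernel (M ≫ N').kernel (P ∘ₖ M.kernel) := by
  have := hP.markov
  exact ⟨inferInstance, by rw [Kernel.fst_comp, hP.fst_eq]; rfl,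
    by rw [Kernel.snd_comp, hP.snd_eq]; rfl⟩

/-- Composing a coupling with a product of `M` with itself gives a coupling of the composites. -/
theorem IsKernelProduct.comp_coupling {W X Y : MMSpace.{u}} {M : X ⟶ Y}
    {Q : Kernel (X × X) (Y × Y)} (hQ : IsKernelProduct M.kernel M.kernel Q) {h h' : W ⟶ X}
    {P : Kernel W (X × X)} (hP : IsKernelCoupling h.kernel h'.kernel P) :
    IsKernelCoupling (h ≫ M).kernel (h' ≫ M).kernel (Q ∘ₖ P) := by
  have := hP.markov
  have := hQ.markov
  refine ⟨inferInstance, ?_, ?_⟩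
  · rw [Kernel.fst_comp, hQ.fst_eq, ← Kernel.comp_map _ _ measurable_fst, ← Kernel.fst_eq,
      hP.fst_eq]
    rfl
  · rw [Kernel.snd_comp, hQ.snd_eq, ← Kernel.comp_map _ _ measurable_snd, ← Kernel.snd_eq,
      hP.snd_eq]
    rfl

/-- The cost of `P ∘ₖ M.kernel` is the cost of `P` integrated against `μ_X M`, which is at most
`μ_Y`. -/
theorem MeasureDecreasing.wassersteinDist_comp_le {p : ℝ} (hp : 1 ≤ p) {X Y : MMSpace.{u}}
    {M : X ⟶ Y} (hM : MeasureDecreasing M) {Z : MMSpace.{u}} (N N' : Y ⟶ Z) :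
    wassersteinDist p (M ≫ N) (M ≫ N') ≤ wassersteinDist p N N' := by
  refine le_iInf₂ fun P hP => (wassersteinDist_le_transportCost p (hP.comp M)).trans ?_
  have hd := Z.measurable_dist.pow_const p
  have hcost : transportCost p (P ∘ₖ M.kernel) =
      (∫⁻ y, ∫⁻ z, Z.d.dist z.1 z.2 ^ p ∂(P y) ∂(X.μ.bind M.kernel)) ^ (1 / p) := by
    rw [transportCost, Measure.lintegral_bind M.kernel.measurable.aemeasurable
      hd.lintegral_kernel.aemeasurable]
    simp_rw [Kernel.lintegral_comp _ _ _ hd]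
  rw [hcost, transportCost]
  gcongr
  exact hM

/-- Integrating the pointwise bound for the product `Q` against a coupling `P` bounds the cost of `Q
∘ₖ P` by that of `P`. -/
theorem DistanceDecreasing.wassersteinDist_comp_le {p : ℝ} (hp : 1 ≤ p) {X Y : MMSpace.{u}}
    {M : X ⟶ Y} (hM : DistanceDecreasing p M) {W : MMSpace.{u}} (h h' : W ⟶ X) :
    wassersteinDist p (h ≫ M) (h' ≫ M) ≤ wassersteinDist p h h' := by
  have hp0 : 0 < p := lt_of_lt_of_le zero_lt_one hp
  obtain ⟨Q, hQ, hQd⟩ := hM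
  refine le_iInf₂ fun P hP =>
    (wassersteinDist_le_transportCost p (hQ.comp_coupling hP)).trans ?_
  rw [transportCost, transportCost]
  simp_rw [Kernel.lintegral_comp _ _ _ (Y.measurable_dist.pow_const p)]
  gcongr with w z
  rw [← ENNReal.rpow_inv_le_iff hp0, ← one_div]
  exact hQd z.1 z.2

/-! ### Test spaces and deterministic kernels -/

/-- The space with two points at distance one from each other, with the zero measure. -/
noncomputable def MMSpace.twoPoint : MMSpace.{u} :=
  letI : TopologicalSpace (ULift.{u} Bool) := ⊥
  letI : MeasurableSpace (ULift.{u} Bool) := ⊤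
  haveI : DiscreteTopology (ULift.{u} Bool) := ⟨rfl⟩
  { carrier := ULift.{u} Bool
    topology := ⊥
    polish := inferInstance
    measurable := ⊤
    borel := inferInstance
    d :=
      { dist := fun a b => if a.down = b.down then 0 else 1
        dist_self := fun a => if_pos rfl
        dist_triangle := by
          rintro ⟨_ | _⟩ ⟨_ | _⟩ ⟨_ | _⟩ <;> simp }
    lsc := continuous_of_discreteTopology.lowerSemicontinuous
    -- This space serves only as a target, and the measure of the target does not enter
    -- `wassersteinDist`.
    μ := 0 }

namespace MMSpace.twoPoint

/-- The first point of the two-point space. -/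
def pt₀ : MMSpace.twoPoint.{u} := (⟨false⟩ : ULift.{u} Bool)

/-- The second point of the two-point space. -/
def pt₁ : MMSpace.twoPoint.{u} := (⟨true⟩ : ULift.{u} Bool)

theorem pt₀_ne_pt₁ : pt₀.{u} ≠ pt₁ := fun h => Bool.false_ne_true (congrArg ULift.down h)

theorem eq_pt₀_or_eq_pt₁ : ∀ a : MMSpace.twoPoint.{u}, a = pt₀ ∨ a = pt₁
  | ⟨false⟩ => Or.inl rfl
  | ⟨true⟩ => Or.inr rfl

theorem dist_pt₀_pt₁ : MMSpace.twoPoint.d.dist pt₀.{u} pt₁ = 1 :=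
  if_neg (t := (0 : ℝ≥0∞)) Bool.false_ne_true

theorem measurableSet_pt₁ : MeasurableSet {pt₁.{u}} := trivial

end MMSpace.twoPoint

/-- The space with one point, of mass one. -/
noncomputable def MMSpace.onePoint : MMSpace.{u} where
  carrier := PUnit
  d := { dist := fun _ _ => 0, dist_self := fun _ => rfl, dist_triangle := fun _ _ _ => zero_le }
  lsc := lowerSemicontinuous_const
  μ := Measure.dirac PUnit.unit

/-- The point of the one-point space. -/
def MMSpace.onePoint.pt : MMSpace.onePoint.{u} := PUnit.unit

theorem MMSpace.onePoint.lintegral_eq (f : MMSpace.onePoint.{u} → ℝ≥0∞) :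
    ∫⁻ a, f a ∂MMSpace.onePoint.μ = f pt :=
  lintegral_dirac (α := PUnit) _ f

/-- The Markov kernel given by a measurable map. -/
noncomputable def MarkovHom.deterministic {X Y : MMSpace.{u}} (f : X → Y) (hf : Measurable f) :
    X ⟶ Y :=
  MarkovHom.mk (Kernel.deterministic f hf)

theorem isKernelCoupling_deterministic {X Y : MMSpace.{u}} {f g : X → Y} (hf : Measurable f)
    (hg : Measurable g) :
    IsKernelCoupling (MarkovHom.deterministic f hf).kernel (MarkovHom.deterministic g hg).kernel
      (Kernel.deterministic (fun x => (f x, g x)) (hf.prodMk hg)) := by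
  refine isKernelCoupling_of_forall inferInstance (fun x => ?_) (fun x => ?_)
  · rw [Kernel.deterministic_apply, Measure.fst, Measure.map_dirac' measurable_fst]
    exact (Kernel.deterministic_apply hf x).symm
  · rw [Kernel.deterministic_apply, Measure.snd, Measure.map_dirac' measurable_snd]
    exact (Kernel.deterministic_apply hg x).symm

theorem wassersteinDist_deterministic_le (p : ℝ) {X Y : MMSpace.{u}} {f g : X → Y}
    (hf : Measurable f) (hg : Measurable g) :
    wassersteinDist p (MarkovHom.deterministic f hf) (MarkovHom.deterministic g hg) ≤
      (∫⁻ x, Y.d.dist (f x) (g x) ^ p ∂X.μ) ^ (1 / p) := by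
  refine (wassersteinDist_le_transportCost p (isKernelCoupling_deterministic hf hg)).trans ?_
  refine le_of_eq (congrArg (· ^ (1 / p)) (lintegral_congr fun x => ?_))
  exact Kernel.lintegral_deterministic' _ (Y.measurable_dist.pow_const p)

open MMSpace.twoPoint in
/-- If the first marginal of `π` is concentrated at the first point of the two-point space, then
the cost of `π` is at least the mass that its second marginal gives to the second point. -/
theorem measure_le_lintegral_twoPoint (p : ℝ)
    {π : Measure (MMSpace.twoPoint.{u} × MMSpace.twoPoint.{u})} (hπ : π.fst {pt₁} = 0) :
    π.snd {pt₁} ≤ ∫⁻ z, MMSpace.twoPoint.d.dist z.1 z.2 ^ p ∂π := by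
  rw [Measure.fst_apply measurableSet_pt₁] at hπ
  rw [Measure.snd_apply measurableSet_pt₁,
    ← lintegral_indicator_one (measurable_snd measurableSet_pt₁)]
  -- Almost everywhere the first coordinate is `pt₀`, so the cost is `1` wherever the second is
  -- `pt₁`.
  refine lintegral_mono_ae ?_
  filter_upwards [measure_eq_zero_iff_ae_notMem.1 hπ] with z hz
  by_cases h2 : z ∈ Prod.snd ⁻¹' {pt₁}
  swap
  · rw [Set.indicator_of_notMem h2]
    exact zero_le
  rw [Set.indicator_of_mem h2, (eq_pt₀_or_eq_pt₁ z.1).resolve_right hz,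
    Set.mem_singleton_iff.1 h2, dist_pt₀_pt₁]
  simp

/-! ### Necessity of the two conditions -/

-- Tests `M` against the constant map `f` and the indicator map `g` of `B`: a coupling of the
-- composites must, at each `x`, move mass `M(B | x)` over distance one.
open MMSpace.twoPoint in
theorem measureDecreasing_of_wassersteinDist_le {p : ℝ} (hp : 1 ≤ p) {X Y : MMSpace.{u}}
    {M : X ⟶ Y}
    (h : ∀ (Z : MMSpace.{u}) (N N' : Y ⟶ Z),
      wassersteinDist p (M ≫ N) (M ≫ N') ≤ wassersteinDist p N N') :
    MeasureDecreasing M := by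
  classical
  have hp0 : 0 < p := lt_of_lt_of_le zero_lt_one hp
  refine Measure.le_iff.2 fun B hB => ?_
  let f : Y → MMSpace.twoPoint.{u} := fun _ => pt₀
  let g : Y → MMSpace.twoPoint.{u} := fun y => if y ∈ B then pt₁ else pt₀
  have hf : Measurable f := measurable_const
  have hg : Measurable g := Measurable.ite hB measurable_const measurable_const
  let N := MarkovHom.deterministic f hf
  let N' := MarkovHom.deterministic g hg
  have hup : wassersteinDist p N N' ≤ Y.μ B ^ (1 / p) := by
    refine (wassersteinDist_deterministic_le p hf hg).trans (le_of_eq ?_)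
    rw [← lintegral_indicator_one hB]
    congr 2 with y
    by_cases hy : y ∈ B <;> simp [f, g, hy, dist_pt₀_pt₁, LawvereMetric.dist_self, hp0]
  have hlow : (X.μ.bind M.kernel) B ^ (1 / p) ≤ wassersteinDist p (M ≫ N) (M ≫ N') := by
    refine le_iInf₂ fun P hP => ?_
    rw [transportCost, Measure.bind_apply hB M.kernel.measurable.aemeasurable]
    gcongr with x
    have h1 : (P x).fst {pt₁} = 0 := by
      rw [hP.fst_apply]
      change (Kernel.deterministic f hf ∘ₖ M.kernel) x _ = 0
      rw [Kernel.deterministic_comp_eq_map hf, Kernel.map_apply' _ hf _ measurableSet_pt₁]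
      convert measure_empty (μ := M.kernel x)
      ext y
      simp [f, pt₀_ne_pt₁]
    have h2 : (P x).snd {pt₁} = M.kernel x B := by
      rw [hP.snd_apply]
      change (Kernel.deterministic g hg ∘ₖ M.kernel) x _ = _
      rw [Kernel.deterministic_comp_eq_map hg, Kernel.map_apply' _ hg _ measurableSet_pt₁]
      congr 1
      ext y
      by_cases hy : y ∈ B <;> simp [g, hy, pt₀_ne_pt₁]
    rw [← h2]
    exact measure_le_lintegral_twoPoint p h1
  exact (ENNReal.rpow_le_rpow_iff (one_div_pos.2 hp0)).1 (hlow.trans ((h _ N N').trans hup))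

/-- Tests `M` on point masses, viewed as kernels from the one-point space, then glues the resulting
couplings measurably. The infimum only yields cost at most `r` for each `r > d(x, x')^p`, which is
the form that the selection theorem accepts. -/
theorem distanceDecreasing_of_wassersteinDist_le {p : ℝ} (hp : 1 ≤ p) {X Y : MMSpace.{u}}
    {M : X ⟶ Y}
    (h : ∀ (W : MMSpace.{u}) (P P' : W ⟶ X),
      wassersteinDist p (P ≫ M) (P' ≫ M) ≤ wassersteinDist p P P') :
    DistanceDecreasing p M := by
  have hp0 : 0 < p := lt_of_lt_of_le zero_lt_one hp
  let M₁ : Kernel (X × X) Y := M.kernel.comap Prod.fst measurable_fst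
  let M₂ : Kernel (X × X) Y := M.kernel.comap Prod.snd measurable_snd
  have key : ∀ (x : X × X) (r : ℝ≥0∞), X.d.dist x.1 x.2 ^ p < r →
      ∃ π : Measure (Y × Y), π.fst = M₁ x ∧ π.snd = M₂ x ∧
        ∫⁻ z, Y.d.dist z.1 z.2 ^ p ∂π ≤ r := by
    intro x r hr
    let δ : X → (MMSpace.onePoint.{u} ⟶ X) := fun a =>
      MarkovHom.deterministic (fun _ => a) measurable_const
    have hδ : ∀ a, (δ a ≫ M).kernel MMSpace.onePoint.pt = M.kernel a := fun a => by
      change (M.kernel ∘ₖ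
        Kernel.deterministic (fun _ : MMSpace.onePoint.{u} => a) measurable_const) _ = _
      rw [Kernel.comp_deterministic_eq_comap]
      rfl
    have h1 : wassersteinDist p (δ x.1 ≫ M) (δ x.2 ≫ M) < r ^ (1 / p) := by
      refine ((h _ _ _).trans (wassersteinDist_deterministic_le p _ _)).trans_lt ?_
      gcongr
      exact (MMSpace.onePoint.lintegral_eq _).trans_lt hr
    simp only [wassersteinDist, iInf_lt_iff] at h1
    obtain ⟨P, hP, hlt⟩ := h1
    refine ⟨P MMSpace.onePoint.pt, (hP.fst_apply _).trans (hδ _), (hP.snd_apply _).trans (hδ _), ?_⟩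
    rw [transportCost, ENNReal.rpow_lt_rpow_iff (one_div_pos.2 hp0)] at hlt
    exact (MMSpace.onePoint.lintegral_eq _).symm.trans_le hlt.le
  obtain ⟨Q, hQ, hQd⟩ := exists_kernelCoupling_le M₁ M₂ (Y.lowerSemicontinuous_dist_rpow hp0.le)
    (X.measurable_dist.pow_const p) key
  refine ⟨Q, ⟨hQ.markov, hQ.fst_eq, hQ.snd_eq⟩, fun x x' => ?_⟩
  rw [one_div, ENNReal.rpow_inv_le_iff hp0]
  exact hQd (x, x')

/-! ### Short morphisms -/

theorem short_mmMarkov_iff (p : ℝ) (hp : 1 ≤ p) {X Y : MMSpace.{u}} (M : X ⟶ Y) :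
    (mmMarkov.{u} p hp).short M ↔ DistanceDecreasing p M ∧ MeasureDecreasing M :=
  ⟨fun h => ⟨distanceDecreasing_of_wassersteinDist_le hp h.2,
    measureDecreasing_of_wassersteinDist_le hp h.1⟩,
  fun h => ⟨fun _ N N' => h.2.wassersteinDist_comp_le hp N N',
    fun _ P P' => h.1.wassersteinDist_comp_le hp P P'⟩⟩

theorem short_mmMarkov_eq (p : ℝ) (hp : 1 ≤ p) :
    (mmMarkov.{u} p hp).short = distMeasDecreasing.{u} p := by
  ext X Y M
  exact short_mmMarkov_iff p hp M

theorem mainTheorem4 (p : ℝ) (hp : 1 ≤ p) :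
    (∀ (X Y : MMSpace.{u}) (M : X ⟶ Y),
      ((∀ (Z : MMSpace.{u}) (N N' : Y ⟶ Z),
          wassersteinDist p (M ≫ N) (M ≫ N') ≤ wassersteinDist p N N') ↔
        MeasureDecreasing M) ∧
      ((∀ (W : MMSpace.{u}) (P P' : W ⟶ X),
          wassersteinDist p (P ≫ M) (P' ≫ M) ≤ wassersteinDist p P P') ↔
        DistanceDecreasing p M) ∧
      ((mmMarkov.{u} p hp).short M ↔ DistanceDecreasing p M ∧ MeasureDecreasing M)) ∧
    (distMeasDecreasing.{u} p).IsMultiplicative ∧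
    (mmMarkov.{u} p hp).short = distMeasDecreasing.{u} p := by
  refine ⟨fun X Y M => ⟨?_, ?_, short_mmMarkov_iff p hp M⟩, ?_, short_mmMarkov_eq p hp⟩
  · exact ⟨measureDecreasing_of_wassersteinDist_le hp,
      fun h _ N N' => h.wassersteinDist_comp_le hp N N'⟩
  · exact ⟨distanceDecreasing_of_wassersteinDist_le hp,
      fun h _ P P' => h.wassersteinDist_comp_le hp P P'⟩
  -- Short morphisms of any metric category contain identities and compose, so no products of
  -- kernels need be composed by hand.
  · rw [← short_mmMarkov_eq p hp]
    infer_instance
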